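/- Let $K\subset\mathbb R^3$ be a convex body (a compact convex set with nonempty interior) that is centrally symmetric, $K=-K$, whose boundary $\partial K$ is a $C^\infty$ hypersurface, and that is strongly convex: with the Minkowski gauge $\mu_K(x)=\min\{\lambda\ge 0 : x\in\lambda K\}$ and $h_K=\tfrac12\mu_K^2$, the Hessian $D^2h_K(x)$ is positive definite for every $x$ with $|x|=1$. Suppose that the four sets $$K\cap\{x\ge0,y\ge0,z\ge0\},\quad K\cap\{x\le0,y\ge0,z\ge0\},\quad K\cap\{x\le0,y\le0,z\ge0\},\quad K\cap\{x\ge0,y\le0,z\ge0\}$$ have the same volume, and that the following pairs of planar sets have equal areas: $$K\cap\{x=0,y\ge0,z\ge0\}\ \text{ and }\ K\cap\{x=0,y\le0,z\ge0\};$$ $$K\cap\{x\ge0,y=0,z\ge0\}\ \text{ and }\ K\cap\{x\ge0,y=0,z\le0\};$$ $$K\cap\{x\ge0,y\ge0,z=0\}\ \text{ and }\ K\cap\{x\le0,y\ge0,z=0\}.$$ For $w\in\operatorname{int}K$ put $K^w=\{u\in\mathbb R^3 : (u-w)\cdot(v-w)\le1\text{ for all }v\in K\}$, and let $K^\circ=K^0$.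 Then the volume product of $K$ satisfies $$\mathcal P(K):=\min_{w\in\operatorname{int}K}|K|\,|K^w|\ \ge\ \frac{32}{3},$$ and in particular $|K|\,|K^\circ|\ge\frac{32}{3}$. -/

import Mathlib

open MeasureTheory
open scoped ContDiff Pointwise ENNReal

noncomputable section

/-- Euclidean three-space. -/
abbrev E3 : Type := EuclideanSpace ℝ (Fin 3)

/-- The polar body of `K` with respect to the point `z`. -/
def polarAt (K : Set E3) (z : E3) : Set E3 :=
  {y | ∀ x ∈ K, inner ℝ (y - z) (x - z) ≤ 1}

/-- The polar body of `K` with respect to the origin. -/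
def polarBody (K : Set E3) : Set E3 := polarAt K 0

/-- The volume product: the infimum over interior points `z` of `|K| |K^z|`. -/
def volumeProduct (K : Set E3) : ℝ≥0∞ :=
  ⨅ z ∈ interior K, volume K * volume (polarAt K z)

/-- `S` is a `C^∞` hypersurface: near each of its points it is the zero set of a smooth
function with nonvanishing derivative. -/
def IsSmoothHypersurface (S : Set E3) : Prop :=
  ∀ p ∈ S, ∃ (U : Set E3) (F : E3 → ℝ), IsOpen U ∧ p ∈ U ∧ ContDiffOn ℝ ∞ F U ∧
    (∀ x ∈ U, fderiv ℝ F x ≠ 0) ∧ ∀ x ∈ U, x ∈ S ↔ F x = 0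

/-- The function `h_K = μ_K ^ 2 / 2`, where `μ_K` is the Minkowski gauge. -/
def halfSqGauge (K : Set E3) (x : E3) : ℝ := gauge K x ^ 2 / 2

/-- The Hessian of `h_K` is positive definite at each point of the unit sphere. -/
def IsStronglyConvexBody (K : Set E3) : Prop :=
  ∀ x : E3, ‖x‖ = 1 → ∀ v : E3, v ≠ 0 → 0 < iteratedFDeriv ℝ 2 (halfSqGauge K) x ![v, v]

/-- Centrally symmetric convex bodies in three-space (with nonempty interior) which have smooth
boundary and are strongly convex. -/
structure IsSmoothStronglyConvexSymm (K : ConvexBody E3) : Prop where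
  nonempty_interior : (interior (K : Set E3)).Nonempty
  symm : (K : Set E3) = -(K : Set E3)
  smooth : IsSmoothHypersurface (frontier (K : Set E3))
  stronglyConvex : IsStronglyConvexBody (K : Set E3)

/-- The parts of `K` in the four octants with `z ≥ 0`. -/
def octant1 (K : Set E3) : Set E3 := K ∩ {p | 0 ≤ p 0 ∧ 0 ≤ p 1 ∧ 0 ≤ p 2}
def octant2 (K : Set E3) : Set E3 := K ∩ {p | p 0 ≤ 0 ∧ 0 ≤ p 1 ∧ 0 ≤ p 2}
def octant3 (K : Set E3) : Set E3 := K ∩ {p | p 0 ≤ 0 ∧ p 1 ≤ 0 ∧ 0 ≤ p 2}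
def octant4 (K : Set E3) : Set E3 := K ∩ {p | 0 ≤ p 0 ∧ p 1 ≤ 0 ∧ 0 ≤ p 2}

/-- The quarter sections of `K` by the coordinate planes, as subsets of these planes.
`quarterD`, `quarterE` lie in the `yz`-plane, with coordinates `(y, z)`. -/
def quarterD (K : Set E3) : Set (ℝ × ℝ) := {q | !₂[0, q.1, q.2] ∈ K ∧ 0 ≤ q.1 ∧ 0 ≤ q.2}
def quarterE (K : Set E3) : Set (ℝ × ℝ) := {q | !₂[0, q.1, q.2] ∈ K ∧ q.1 ≤ 0 ∧ 0 ≤ q.2}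
/-- `quarterF`, `quarterG` lie in the `zx`-plane, with coordinates `(x, z)`. -/
def quarterF (K : Set E3) : Set (ℝ × ℝ) := {q | !₂[q.1, 0, q.2] ∈ K ∧ 0 ≤ q.1 ∧ 0 ≤ q.2}
def quarterG (K : Set E3) : Set (ℝ × ℝ) := {q | !₂[q.1, 0, q.2] ∈ K ∧ 0 ≤ q.1 ∧ q.2 ≤ 0}
/-- `quarterH`, `quarterI` lie in the `xy`-plane, with coordinates `(x, y)`. -/
def quarterH (K : Set E3) : Set (ℝ × ℝ) := {q | !₂[q.1, q.2, 0] ∈ K ∧ 0 ≤ q.1 ∧ 0 ≤ q.2}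
def quarterI (K : Set E3) : Set (ℝ × ℝ) := {q | !₂[q.1, q.2, 0] ∈ K ∧ q.1 ≤ 0 ∧ 0 ≤ q.2}

/-- The four upper octant parts of `K` have equal volume, and in each coordinate plane two
adjacent quarter sections have equal area. -/
structure IsEquipartitioned (K : Set E3) : Prop where
  vol12 : volume (octant1 K) = volume (octant2 K)
  vol23 : volume (octant2 K) = volume (octant3 K)
  vol34 : volume (octant3 K) = volume (octant4 K)
  areaDE : volume (quarterD K) = volume (quarterE K)
  areaFG : volume (quarterF K) = volume (quarterG K)
  areaHI : volume (quarterH K) = volume (quarterI K)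

end

/-! Let `V` be the common volume of the octant parts of `K`, and `a i` the common area of the
quarters of its `i`-th coordinate section. For `Q ∈ K`, the cones with apex `Q` over the three
quarters bordering the octant of `Q` are disjoint and lie in that part of `K`, so `∑ a i |Q i| ≤ 3V`
(`sum_mul_abs_le`). Dually, the box `|u i| ≤ a i / (3V)` lies in the polar body.

If a compact convex set `A` contains a box `B` with half-sides `s i`, then `A + tB ⊆ (1 + t)A`;
comparing first-order growth of volumes at `t = 0` bounds the projections `P i A` by `∑ 2 s i |P i
A| ≤ 3|A|` (`sum_proj_le_of_box_subset`). For `A` the polar of `K`, `P i A` contains the polar of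
the `i`-th section (`coordPolar_section_subset`). Hence a lower bound `β` for `a i` times the polar
area of every section gives `V |A| ≥ 2β/3`.

The same argument in dimension `n + 1` has factor `2 / (n + 1)`
(`le_mul_volume_coordPolar_of_sections`). Starting from `1` in dimension `0`, it yields `2`, `2` and
`4/3`; since `|K| ≥ 8V`, the product is at least `32/3`. For symmetric `K`, moving the centre of
polarity away from the origin cannot decrease the polar volume (`volume_polarBody_le_polarAt`). -/

/-- The part of `K` in the open orthant with signs `e`. -/
def orthantPart {n : ℕ} (e : Fin n → ℝ) (K : Set (Fin n → ℝ)) : Set (Fin n → ℝ) :=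
  {p | p ∈ K ∧ ∀ i, 0 < e i * p i}

/-- The section of `K` by the `i`-th coordinate hyperplane. -/
def coordSection {n : ℕ} (i : Fin (n + 1)) (K : Set (Fin (n + 1) → ℝ)) : Set (Fin n → ℝ) :=
  {q | i.insertNth (0 : ℝ) q ∈ K}

/-- The polar of `K` in coordinates. -/
def coordPolar {n : ℕ} (K : Set (Fin n → ℝ)) : Set (Fin n → ℝ) :=
  {u | ∀ p ∈ K, ∑ i, u i * p i ≤ 1}

/-- A vector all of whose coordinates are `1` or `-1`. -/
def IsSignVector {n : ℕ} (e : Fin n → ℝ) : Prop := ∀ i, e i = 1 ∨ e i = -1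

/-! ### Fubini along one coordinate. -/

theorem continuous_insertNth_uncurry {n : ℕ} (i : Fin (n + 1)) :
    Continuous fun z : ℝ × (Fin n → ℝ) => (i.insertNth z.1 z.2 : Fin (n + 1) → ℝ) :=
  Continuous.finInsertNth (A := fun _ => ℝ) i continuous_fst continuous_snd

theorem measurePreserving_insertNth {n : ℕ} (i : Fin (n + 1)) :
    MeasurePreserving (fun z : ℝ × (Fin n → ℝ) => (i.insertNth z.1 z.2 : Fin (n + 1) → ℝ)) :=
  (volume_preserving_piFinSuccAbove (fun _ : Fin (n + 1) => ℝ) i).symm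

theorem volume_eq_lintegral_slice {n : ℕ} (i : Fin (n + 1)) {A : Set (Fin (n + 1) → ℝ)}
    (hA : MeasurableSet A) :
    volume A = ∫⁻ x : ℝ, volume {q : Fin n → ℝ | i.insertNth x q ∈ A} := by
  have h := measurePreserving_insertNth (n := n) i
  rw [← h.measure_preimage hA.nullMeasurableSet, Measure.volume_eq_prod,
    Measure.prod_apply (h.measurable hA)]
  rfl

theorem volume_eq_lintegral_line {n : ℕ} (i : Fin (n + 1)) {A : Set (Fin (n + 1) → ℝ)}
    (hA : MeasurableSet A) :
    volume A = ∫⁻ q : Fin n → ℝ, volume {x : ℝ | i.insertNth x q ∈ A} := by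
  have h := measurePreserving_insertNth (n := n) i
  rw [← h.measure_preimage hA.nullMeasurableSet, Measure.volume_eq_prod,
    Measure.prod_apply_symm (h.measurable hA)]
  rfl

/-! ### Cones over coordinate sections. -/

/-- The open cone with apex `Q` and base `S` in the `i`-th coordinate hyperplane. -/
def apexCone {n : ℕ} (i : Fin (n + 1)) (Q : Fin (n + 1) → ℝ) (S : Set (Fin n → ℝ)) :
    Set (Fin (n + 1) → ℝ) :=
  {p | p i / Q i ∈ Set.Ioo (0 : ℝ) 1 ∧
    (1 - p i / Q i)⁻¹ • (i.removeNth p - (p i / Q i) • i.removeNth Q) ∈ S}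

theorem measurableSet_apexCone {n : ℕ} (i : Fin (n + 1)) (Q : Fin (n + 1) → ℝ)
    {S : Set (Fin n → ℝ)} (hS : MeasurableSet S) : MeasurableSet (apexCone i Q S) := by
  have h1 : Measurable fun p : Fin (n + 1) → ℝ => p i / Q i := by fun_prop
  have h2 : Measurable fun p : Fin (n + 1) → ℝ => i.removeNth p := by
    unfold Fin.removeNth; fun_prop
  have h3 : Measurable fun p : Fin (n + 1) → ℝ =>
      (1 - p i / Q i)⁻¹ • (i.removeNth p - (p i / Q i) • i.removeNth Q) :=
    (measurable_const.sub h1).inv.smul (h2.sub (h1.smul measurable_const))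
  exact (h1 measurableSet_Ioo).inter (h3 hS)

theorem integral_indicator_one_sub_pow (n : ℕ) :
    ∫ s : ℝ, (Set.Ioo (0 : ℝ) 1).indicator (fun s => (1 - s) ^ n) s = 1 / (n + 1) := by
  rw [integral_indicator measurableSet_Ioo, ← integral_Ioc_eq_integral_Ioo,
    ← intervalIntegral.integral_of_le zero_le_one,
    intervalIntegral.integral_comp_sub_left (fun s : ℝ => s ^ n) 1]
  simp

/-- The slice at relative height `s = p i / Q i` is a translate of `(1 - s) • S`; integrating `(1 -
s) ^ n` gives `1 / (n + 1)`. -/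
theorem volume_apexCone {n : ℕ} (i : Fin (n + 1)) (Q : Fin (n + 1) → ℝ)
    {S : Set (Fin n → ℝ)} (hS : MeasurableSet S) :
    volume (apexCone i Q S) = ENNReal.ofReal (|Q i| / (n + 1)) * volume S := by
  -- Division by zero makes the relative height `0`, so a degenerate cone is empty.
  rcases eq_or_ne (Q i) 0 with hQ | hQ
  · have : apexCone i Q S = ∅ := by
      ext p; simp [apexCone, hQ]
    simp [this, hQ]
  set g : ℝ → ℝ := (Set.Ioo (0 : ℝ) 1).indicator (fun s => (1 - s) ^ n) with hg
  have hg0 : ∀ s, 0 ≤ g s := fun s => by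
    refine Set.indicator_nonneg (fun s hs => ?_) s
    have := hs.2
    exact pow_nonneg (by linarith) n
  have hgInt : Integrable g := by
    refine (integrable_indicator_iff measurableSet_Ioo).2 ?_
    have : ContinuousOn (fun s : ℝ => (1 - s) ^ n) (Set.Icc 0 1) := by fun_prop
    exact (this.integrableOn_compact isCompact_Icc).mono_set Set.Ioo_subset_Icc_self
  have hgInt_comp : Integrable fun x => g (x / Q i) := hgInt.comp_div hQ
  have slice : ∀ x : ℝ, volume {q : Fin n → ℝ | i.insertNth x q ∈ apexCone i Q S}
      = ENNReal.ofReal (g (x / Q i)) * volume S := by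
    intro x
    by_cases hx : x / Q i ∈ Set.Ioo (0 : ℝ) 1
    · have h1 : 0 < 1 - x / Q i := by have := hx.2; linarith
      have : {q : Fin n → ℝ | i.insertNth x q ∈ apexCone i Q S} =
          (fun q => q + -((x / Q i) • i.removeNth Q)) ⁻¹'
            ((fun q => (1 - x / Q i)⁻¹ • q) ⁻¹' S) := by
        ext q
        simp only [apexCone, Set.mem_ofPred_eq, Fin.insertNth_apply_same, hx, true_and,
          Fin.removeNth_insertNth, Set.mem_preimage, sub_eq_add_neg]
      rw [this, measure_preimage_add_right,
        Measure.addHaar_preimage_smul _ (inv_ne_zero h1.ne'), hg,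
        Set.indicator_of_mem hx]
      simp [abs_of_pos h1]
    · have : {q : Fin n → ℝ | i.insertNth x q ∈ apexCone i Q S} = ∅ := by
        ext q
        simp only [apexCone, Set.mem_ofPred_eq, Fin.insertNth_apply_same, hx, false_and,
          Set.mem_empty_iff_false]
      rw [this, hg, Set.indicator_of_notMem hx]
      simp
  rw [volume_eq_lintegral_slice i (measurableSet_apexCone i Q hS)]
  simp_rw [slice]
  rw [lintegral_mul_const'' _ hgInt_comp.1.aemeasurable.ennreal_ofReal,
    ← ofReal_integral_eq_lintegral_ofReal hgInt_comp (Filter.Eventually.of_forall fun x => hg0 _),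
    Measure.integral_comp_div, integral_indicator_one_sub_pow]
  simp [div_eq_mul_inv]

/-- Here `p = s Q + (1 - s) q` with `q` in the base. The `i`-th coordinate of `q` vanishes and the
others have the strict signs of `e`, so among the ratios `p j / Q j` the `i`-th is the strict
minimum. This identifies the cone containing `p`. -/
theorem mem_of_mem_apexCone {n : ℕ} {K : Set (Fin (n + 1) → ℝ)} (hK : Convex ℝ K)
    {i : Fin (n + 1)} {Q e : Fin (n + 1) → ℝ} (hQ : Q ∈ K) {p : Fin (n + 1) → ℝ}
    (hp : p ∈ apexCone i Q (orthantPart (i.removeNth e) (coordSection i K))) :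
    p ∈ K ∧ e i * p i = (p i / Q i) * (e i * Q i) ∧
      ∀ j, j ≠ i → (p i / Q i) * (e j * Q j) < e j * p j := by
  obtain ⟨⟨h0, h1⟩, hmem, hlt⟩ := hp
  set s := p i / Q i with hs
  have hQi : Q i ≠ 0 := by
    rintro h; rw [h, div_zero] at hs; linarith
  set q := (1 - s)⁻¹ • (i.removeNth p - s • i.removeNth Q) with hq
  have h1s : 0 < 1 - s := by linarith
  have hpi : p i = s * Q i := by rw [hs]; field_simp
  have hpj : ∀ j, p (i.succAbove j) = s * Q (i.succAbove j) + (1 - s) * q j := by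
    intro j
    have : q j = (1 - s)⁻¹ * (p (i.succAbove j) - s * Q (i.succAbove j)) := rfl
    rw [this]; field_simp; ring
  refine ⟨?_, by rw [hpi]; ring, ?_⟩
  · have := hK hQ hmem h0.le h1s.le (by ring)
    convert this using 1
    ext j
    refine Fin.succAboveCases i ?_ (fun j => ?_) j
    · simp [hpi]
    · simp [hpj j]
  · intro j
    refine Fin.succAboveCases i ?_ (fun j => ?_) j
    · exact fun h => absurd rfl h
    · intro _
      have : 0 < e (i.succAbove j) * q j := hlt j
      rw [hpj]
      nlinarith [mul_pos h1s this]

theorem measurableSet_orthantPart {n : ℕ} (e : Fin n → ℝ) {K : Set (Fin n → ℝ)}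
    (hK : MeasurableSet K) : MeasurableSet (orthantPart e K) := by
  refine hK.inter ?_
  change MeasurableSet {p : Fin n → ℝ | ∀ i, 0 < e i * p i}
  rw [Set.ofPred_forall]
  exact MeasurableSet.iInter fun i => measurableSet_lt (by fun_prop) (by fun_prop)

theorem isClosed_coordSection {n : ℕ} (i : Fin (n + 1)) {K : Set (Fin (n + 1) → ℝ)}
    (hK : IsClosed K) : IsClosed (coordSection i K) :=
  hK.preimage ((continuous_insertNth_uncurry i).comp (Continuous.prodMk_right (0 : ℝ)))

theorem sum_le_volume_orthantPart {n : ℕ} {K : Set (Fin (n + 1) → ℝ)} (hc : IsClosed K)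
    (hK : Convex ℝ K) {Q e : Fin (n + 1) → ℝ} (hQ : Q ∈ K) (he : ∀ j, e j ≠ 0)
    (hpos : ∀ j, 0 ≤ e j * Q j) :
    ∑ i, ENNReal.ofReal (|Q i| / (n + 1)) *
        volume (orthantPart (i.removeNth e) (coordSection i K)) ≤
      volume (orthantPart e K) := by
  set S := fun i : Fin (n + 1) => orthantPart (i.removeNth e) (coordSection i K) with hSdef
  have hS : ∀ i, MeasurableSet (S i) := fun i =>
    measurableSet_orthantPart _ (isClosed_coordSection i hc).measurableSet
  have hposi : ∀ i p, p ∈ apexCone i Q (S i) → 0 < e i * Q i := by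
    intro i p hp
    refine lt_of_le_of_ne (hpos i) (mul_ne_zero (he i) ?_).symm
    intro h
    have := hp.1.1
    simp [h] at this
  calc ∑ i, ENNReal.ofReal (|Q i| / (n + 1)) * volume (S i)
      = ∑ i, volume (apexCone i Q (S i)) := by simp_rw [volume_apexCone _ Q (hS _)]
    _ = volume (⋃ i ∈ (Finset.univ : Finset (Fin (n + 1))), apexCone i Q (S i)) := by
        refine (measure_biUnion_finset ?_ fun i _ => measurableSet_apexCone i Q (hS i)).symm
        intro i _ j _ hij
        refine Set.disjoint_left.2 fun p hpi hpj => ?_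
        have hi := (mem_of_mem_apexCone hK hQ hpi).2
        have hj := (mem_of_mem_apexCone hK hQ hpj).2
        have hQi := hposi i p hpi
        have hQj := hposi j p hpj
        have h1 := hi.2 j hij.symm
        have h2 := hj.2 i hij
        rw [hj.1] at h1
        rw [hi.1] at h2
        -- A common point would have each of its `i`-th and `j`-th ratios strictly below the other.
        exact lt_asymm (lt_of_mul_lt_mul_right h1 hQj.le) (lt_of_mul_lt_mul_right h2 hQi.le)
    _ ≤ volume (orthantPart e K) := by
        refine measure_mono (Set.iUnion₂_subset fun i _ p hp => ?_)
        have h := mem_of_mem_apexCone hK hQ hp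
        refine ⟨h.1, fun j => ?_⟩
        rcases eq_or_ne j i with rfl | hji
        · rw [h.2.1]; exact mul_pos hp.1.1 (hposi _ p hp)
        · exact lt_of_le_of_lt (mul_nonneg hp.1.1.le (hpos j)) (h.2.2 j hji)

/-! ### Thickening by boxes and coordinate projections. -/

/-- The segment from `-s` to `s` on the `i`-th axis. -/
def axisSegment {n : ℕ} (i : Fin n) (s : ℝ) : Set (Fin n → ℝ) :=
  (fun x : ℝ => Pi.single i x) '' Set.Icc (-s) s

theorem isCompact_axisSegment {n : ℕ} (i : Fin n) (s : ℝ) : IsCompact (axisSegment i s) :=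
  isCompact_Icc.image (continuous_single (A := fun _ : Fin n => ℝ) i)

theorem convex_axisSegment {n : ℕ} (i : Fin n) (s : ℝ) : Convex ℝ (axisSegment i s) :=
  (convex_Icc (-s) s).linear_image (LinearMap.single ℝ (fun _ : Fin n => ℝ) i)

theorem continuous_removeNth {n : ℕ} (i : Fin (n + 1)) :
    Continuous fun p : Fin (n + 1) → ℝ => i.removeNth p := by
  unfold Fin.removeNth; fun_prop

/-- Every line in direction `i` that meets `A` does so in a compact interval, which the sum
lengthens by `s` at both ends; such lines are indexed by the projection of `A`. -/
theorem volume_add_axisSegment {n : ℕ} (i : Fin (n + 1)) {A : Set (Fin (n + 1) → ℝ)}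
    (hc : IsCompact A) (hA : Convex ℝ A) {s : ℝ} (hs : 0 ≤ s) :
    volume A + ENNReal.ofReal (2 * s) * volume (i.removeNth '' A) ≤
      volume (A + axisSegment i s) := by
  have hproj : MeasurableSet (i.removeNth '' A) :=
    (hc.image (continuous_removeNth i)).measurableSet
  have hsum : MeasurableSet (A + axisSegment i s) :=
    (hc.add (isCompact_axisSegment i s)).measurableSet
  have hline : ∀ q : Fin n → ℝ, Continuous fun x : ℝ => (i.insertNth x q : Fin (n + 1) → ℝ) :=
    fun q => (continuous_insertNth_uncurry i).comp (Continuous.prodMk_left q)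
  rw [volume_eq_lintegral_line i hsum, volume_eq_lintegral_line i hc.measurableSet,
    ← setLIntegral_const, ← lintegral_indicator hproj,
    ← lintegral_add_right _ (measurable_const.indicator hproj)]
  refine lintegral_mono fun q => ?_
  by_cases hq : q ∈ i.removeNth '' A
  · rw [Set.indicator_of_mem hq]
    set T := {x : ℝ | i.insertNth x q ∈ A} with hT
    have hTne : T.Nonempty := by
      obtain ⟨p, hp, rfl⟩ := hq
      exact ⟨p i, by simpa [hT] using hp⟩
    have hTcl : IsClosed T := hc.isClosed.preimage (hline q)
    have hTbd : Bornology.IsBounded T := by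
      refine (hc.image (continuous_apply i)).isBounded.subset ?_
      intro x hx
      exact ⟨_, hx, by simp⟩
    have hTc : IsCompact T := Metric.isCompact_of_isClosed_isBounded hTcl hTbd
    have ha := hTc.sInf_mem hTne
    have hb := hTc.sSup_mem hTne
    set a := sInf T
    set b := sSup T
    have hab : a ≤ b := csInf_le_csSup hTne hTc.bddBelow hTc.bddAbove
    have hTsub : T ⊆ Set.Icc a b := fun x hx =>
      ⟨csInf_le hTc.bddBelow hx, le_csSup hTc.bddAbove hx⟩
    have hconv : Set.Icc a b ⊆ T := by
      intro x hx
      obtain ⟨u, v, hu, hv, huv, rfl⟩ := (segment_eq_Icc hab).symm ▸ hx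
      have := hA ha hb hu hv huv
      change i.insertNth (u • a + v • b) q ∈ A
      convert this using 1
      ext j
      refine Fin.succAboveCases i ?_ (fun j => ?_) j
      · simp
      · simp [← add_mul, huv]
    have hsup : Set.Icc (a - s) (b + s) ⊆ {x | i.insertNth x q ∈ A + axisSegment i s} := by
      intro x hx
      have : ∃ y ∈ Set.Icc a b, x - y ∈ Set.Icc (-s) s := by
        -- The witness is the point of `[a, b]` nearest to `x`.
        refine ⟨max a (min x b), ⟨le_max_left _ _, max_le hab (min_le_right _ _)⟩, ?_⟩
        obtain ⟨h1, h2⟩ := hx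
        rcases max_cases a (min x b) with h | h <;> rcases min_cases x b with h' | h' <;>
          constructor <;> linarith
      obtain ⟨y, hy, hxy⟩ := this
      refine ⟨_, hconv hy, _, ⟨x - y, hxy, rfl⟩, ?_⟩
      ext j
      refine Fin.succAboveCases i ?_ (fun j => ?_) j
      · simp
      · simp
    calc volume T + ENNReal.ofReal (2 * s)
        ≤ volume (Set.Icc a b) + ENNReal.ofReal (2 * s) := by gcongr
      _ = volume (Set.Icc (a - s) (b + s)) := by
          rw [Real.volume_Icc, Real.volume_Icc, ← ENNReal.ofReal_add (by linarith) (by linarith)]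
          congr 1; ring
      _ ≤ _ := measure_mono hsup
  · rw [Set.indicator_of_notMem hq, add_zero]
    refine measure_mono fun x hx => ?_
    exact ⟨_, hx, 0, ⟨0, by simpa using hs, by simp⟩, by simp⟩

/-- Segments are added one at a time. Each contains `0`, so the projections of the partial sums
contain those of `A`. -/
theorem volume_add_sum_axisSegment {n : ℕ} {A : Set (Fin (n + 1) → ℝ)}
    (hc : IsCompact A) (hA : Convex ℝ A) {s : Fin (n + 1) → ℝ} (hs : ∀ i, 0 ≤ s i)
    (t : Finset (Fin (n + 1))) :
    volume A + ∑ i ∈ t, ENNReal.ofReal (2 * s i) * volume (i.removeNth '' A) ≤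
      volume (A + ∑ i ∈ t, axisSegment i (s i)) := by
  have hcs : ∀ t : Finset (Fin (n + 1)), IsCompact (∑ i ∈ t, axisSegment i (s i)) := fun t =>
    Finset.sum_induction _ IsCompact (fun _ _ h h' => h.add h') isCompact_singleton
      fun i _ => isCompact_axisSegment i _
  have hvs : ∀ t : Finset (Fin (n + 1)), Convex ℝ (∑ i ∈ t, axisSegment i (s i)) := fun t =>
    Finset.sum_induction _ (Convex ℝ) (fun _ _ h h' => h.add h') (convex_singleton 0)
      fun i _ => convex_axisSegment i _
  have h0 : ∀ t : Finset (Fin (n + 1)), (0 : Fin (n + 1) → ℝ) ∈ ∑ i ∈ t, axisSegment i (s i) :=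
    fun t => Finset.sum_induction _ (fun B => (0 : Fin (n + 1) → ℝ) ∈ B)
      (fun _ _ h h' => ⟨0, h, 0, h', add_zero 0⟩) rfl
      fun i _ => ⟨0, by simpa using hs i, by simp⟩
  induction t using Finset.induction_on with
  | empty => simp
  | insert i t hi ih =>
    rw [Finset.sum_insert hi, Finset.sum_insert hi, add_comm (axisSegment i (s i)), ← add_assoc A]
    calc _ = (volume A + ∑ i ∈ t, ENNReal.ofReal (2 * s i) * volume (i.removeNth '' A)) +
          ENNReal.ofReal (2 * s i) * volume (i.removeNth '' A) := by
            rw [add_assoc, add_comm (∑ i ∈ t, _)]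
      _ ≤ volume (A + ∑ i ∈ t, axisSegment i (s i)) + ENNReal.ofReal (2 * s i) *
          volume (i.removeNth '' (A + ∑ i ∈ t, axisSegment i (s i))) := by
            gcongr
            exact fun x hx => ⟨x, hx, 0, h0 t, add_zero x⟩
      _ ≤ _ := volume_add_axisSegment i (hc.add (hcs t)) (hA.add (hvs t)) (hs i)

/-- A compact convex set containing a centred box has volume bounded below by its coordinate
projections. -/
theorem sum_proj_le_of_box_subset {n : ℕ} {A : Set (Fin (n + 1) → ℝ)}
    (hc : IsCompact A) (hA : Convex ℝ A) {s : Fin (n + 1) → ℝ} (hs : ∀ i, 0 ≤ s i)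
    (hbox : ∀ u : Fin (n + 1) → ℝ, (∀ i, |u i| ≤ s i) → u ∈ A) :
    ∑ i, 2 * s i * volume.real (i.removeNth '' A) ≤ (n + 1) * volume.real A := by
  set V := volume.real A
  set S := ∑ i, 2 * s i * volume.real (i.removeNth '' A)
  -- The sum of the segments scaled by `t` is `t` times the box, hence inside `t • A`, and `A + t •
  -- A = (1 + t) • A` by convexity.
  have key : ∀ t : ℝ, 0 < t → V + t * S ≤ (1 + t) ^ (n + 1) * V := by
    intro t ht
    have h1 := volume_add_sum_axisSegment hc hA (s := fun i => t * s i)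
      (fun i => mul_nonneg ht.le (hs i)) Finset.univ
    have h2 : A + ∑ i, axisSegment i (t * s i) ⊆ (1 + t) • A := by
      rw [hA.add_smul zero_le_one ht.le, one_smul]
      refine Set.add_subset_add_left fun x hx => ?_
      obtain ⟨g, hg, rfl⟩ := (Set.mem_fintype_sum _ _).1 hx
      choose y hy hyg using hg
      refine ⟨t⁻¹ • y, hbox _ fun i => ?_, ?_⟩
      · have : |y i| ≤ t * s i := abs_le.2 (hy i)
        rw [Pi.smul_apply, smul_eq_mul, abs_mul, abs_of_pos (inv_pos.2 ht)]
        rwa [inv_mul_le_iff₀ ht]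
      · simp only [smul_smul, mul_inv_cancel₀ ht.ne', one_smul]
        ext j
        simp [← hyg, Finset.sum_apply, Pi.single_apply]
    have h3 := h1.trans (measure_mono h2)
    rw [Measure.addHaar_smul, Module.finrank_fin_fun, abs_of_pos (by positivity)] at h3
    have hfin : volume A ≠ ⊤ := hc.measure_lt_top.ne
    have hfin' : ∀ i : Fin (n + 1), volume (i.removeNth '' A) ≠ ⊤ := fun i =>
      (hc.image (continuous_removeNth i)).measure_lt_top.ne
    have h4 := ENNReal.toReal_mono (ENNReal.mul_ne_top ENNReal.ofReal_ne_top hfin) h3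
    have hfin2 : ∀ i ∈ (Finset.univ : Finset (Fin (n + 1))),
        ENNReal.ofReal (2 * (t * s i)) * volume (i.removeNth '' A) ≠ ⊤ := fun i _ =>
      ENNReal.mul_ne_top ENNReal.ofReal_ne_top (hfin' i)
    rw [ENNReal.toReal_add hfin (ENNReal.sum_ne_top.2 hfin2), ENNReal.toReal_sum hfin2,
      ENNReal.toReal_mul, ENNReal.toReal_ofReal (by positivity)] at h4
    refine le_trans (le_of_eq ?_) h4
    rw [Finset.mul_sum]
    refine congrArg (V + ·) ?_
    refine Finset.sum_congr rfl fun i _ => ?_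
    rw [ENNReal.toReal_mul, ENNReal.toReal_ofReal (by have := hs i; positivity)]
    simp only [Measure.real]; ring
  -- By `key` this function is at least its value `V` at `0` for `t > 0`, so its derivative there is
  -- nonnegative.
  have hder : HasDerivAt (fun t : ℝ => (1 + t) ^ (n + 1) * V - t * S)
      ((n + 1) * V - S) 0 := by
    have := ((((hasDerivAt_id (0 : ℝ)).const_add 1).pow (n + 1)).mul_const V).sub
      ((hasDerivAt_id (0 : ℝ)).mul_const S)
    refine (this.congr_deriv (by simp)).congr_of_eventuallyEq ?_
    exact Filter.Eventually.of_forall fun t => by simp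
  have hlim := hder.tendsto_slope_zero_right
  have : 0 ≤ (n + 1) * V - S := by
    refine ge_of_tendsto hlim ?_
    filter_upwards [self_mem_nhdsWithin] with t ht
    have := key t ht
    have ht' : (0 : ℝ) < t := ht
    simp only [zero_add, add_zero, one_pow, one_mul, zero_mul, sub_zero, smul_eq_mul]
    exact mul_nonneg (inv_nonneg.2 ht'.le) (by linarith)
  linarith

/-! ### Polars, sections and projections. -/

/-- A linear functional on a coordinate hyperplane bounded by `1` on the section of `K` extends
to one bounded by `1` on `K`. -/
theorem coordPolar_section_subset {n : ℕ} {K : Set (Fin (n + 1) → ℝ)} (hK : Convex ℝ K)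
    (h0 : 0 ∈ interior K) (i : Fin (n + 1)) :
    coordPolar (coordSection i K) ⊆ i.removeNth '' coordPolar K := by
  intro v hv
  set φ : (Fin (n + 1) → ℝ) → ℝ := fun p => ∑ j, v j * p (i.succAbove j) with hφ
  have hφadd : ∀ (a b : ℝ) (p q : Fin (n + 1) → ℝ), φ (a • p + b • q) = a * φ p + b * φ q := by
    intro a b p q
    simp only [hφ, Finset.mul_sum, ← Finset.sum_add_distrib]
    refine Finset.sum_congr rfl fun j _ => ?_
    simp; ring
  have hzero : ∀ p ∈ K, p i = 0 → φ p ≤ 1 := by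
    intro p hp hpi
    refine hv (i.removeNth p) ?_
    change i.insertNth (0 : ℝ) (i.removeNth p) ∈ K
    rwa [Fin.insertNth_removeNth, ← hpi, Function.update_eq_self]
  -- A coefficient `c` for the missing coordinate must satisfy `c * p i + φ p ≤ 1` on `K`: points
  -- with `p i < 0` bound it below, points with `q i > 0` above. The bounds are compatible because
  -- the segment from `p` to `q` crosses the hyperplane inside `K`, where `hzero` applies.
  have cross : ∀ p ∈ K, ∀ q ∈ K, p i < 0 → 0 < q i →
      (1 - φ p) / p i ≤ (1 - φ q) / q i := by
    intro p hp q hq hpi hqi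
    have hd : 0 < q i - p i := by linarith
    have hmem := hK hp hq (a := q i / (q i - p i)) (b := -p i / (q i - p i))
      (by positivity) (div_nonneg (by linarith) hd.le) (by field_simp; ring)
    have h := hzero _ hmem (by simp; field_simp; ring)
    rw [hφadd, div_mul_eq_mul_div, div_mul_eq_mul_div, ← add_div, div_le_one hd] at h
    rw [div_le_iff_of_neg hpi, div_mul_eq_mul_div, div_le_iff₀ hqi]
    nlinarith
  obtain ⟨r, hr, hball⟩ := Metric.mem_nhds_iff.1 (mem_interior_iff_mem_nhds.1 h0)
  have hsingle : ∀ x : ℝ, |x| < r → (Pi.single i x : Fin (n + 1) → ℝ) ∈ K := by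
    intro x hx
    refine hball ?_
    rw [mem_ball_zero_iff]
    simpa [Pi.norm_single] using hx
  have hp0 : (Pi.single i (-(r / 2)) : Fin (n + 1) → ℝ) ∈ K :=
    hsingle _ (by rw [abs_neg, abs_of_pos] <;> linarith)
  have hq0 : (Pi.single i (r / 2) : Fin (n + 1) → ℝ) ∈ K :=
    hsingle _ (by rw [abs_of_pos] <;> linarith)
  -- The lower bounds on the coefficient; their supremum is the one used. The points `hp0` and `hq0`
  -- make `T` nonempty and bounded above.
  set T := {c : ℝ | ∃ p ∈ K, p i < 0 ∧ c = (1 - φ p) / p i}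
  have hTne : T.Nonempty := ⟨_, _, hp0, by simpa using hr, rfl⟩
  have hTub : ∀ q ∈ K, 0 < q i → ∀ c ∈ T, c ≤ (1 - φ q) / q i := by
    rintro q hq hqi c ⟨p, hp, hpi, rfl⟩
    exact cross p hp q hq hpi hqi
  refine ⟨i.insertNth (sSup T) v, fun p hp => ?_, by simp⟩
  rw [Fin.sum_univ_succAbove _ i]
  simp only [Fin.insertNth_apply_same, Fin.insertNth_apply_succAbove]
  change sSup T * p i + φ p ≤ 1
  rcases lt_trichotomy (p i) 0 with h | h | h
  · have : (1 - φ p) / p i ≤ sSup T :=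
      le_csSup ⟨_, hTub _ hq0 (by simpa using hr)⟩ ⟨p, hp, h, rfl⟩
    rw [div_le_iff_of_neg h] at this
    linarith
  · rw [h, mul_zero, zero_add]; exact hzero p hp h
  · have : sSup T ≤ (1 - φ p) / p i := csSup_le hTne (hTub p hp h)
    rw [le_div_iff₀ h] at this
    linarith

theorem isClosed_coordPolar {n : ℕ} (K : Set (Fin n → ℝ)) : IsClosed (coordPolar K) := by
  simp only [coordPolar, Set.ofPred_forall]
  exact isClosed_iInter fun p => isClosed_iInter fun _ =>
    isClosed_le (by fun_prop) continuous_const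

theorem convex_coordPolar {n : ℕ} (K : Set (Fin n → ℝ)) : Convex ℝ (coordPolar K) := by
  intro u hu v hv a b ha hb hab p hp
  have h1 := hu p hp
  have h2 := hv p hp
  have : ∑ i, (a • u + b • v) i * p i = a * ∑ i, u i * p i + b * ∑ i, v i * p i := by
    simp only [Finset.mul_sum, ← Finset.sum_add_distrib]
    refine Finset.sum_congr rfl fun j _ => ?_
    simp; ring
  rw [this]
  nlinarith

theorem exists_single_mem_of_zero_mem_interior {n : ℕ} {K : Set (Fin n → ℝ)}
    (h0 : 0 ∈ interior K) :
    ∃ r > 0, ∀ i, ∀ x : ℝ, |x| ≤ r → (Pi.single i x : Fin n → ℝ) ∈ K := by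
  obtain ⟨r, hr, hball⟩ := Metric.mem_nhds_iff.1 (mem_interior_iff_mem_nhds.1 h0)
  refine ⟨r / 2, half_pos hr, fun i x hx => hball ?_⟩
  rw [mem_ball_zero_iff]
  simpa [Pi.norm_single] using lt_of_le_of_lt hx (half_lt_self hr)

theorem isCompact_coordPolar {n : ℕ} {K : Set (Fin n → ℝ)} (h0 : 0 ∈ interior K) :
    IsCompact (coordPolar K) := by
  obtain ⟨r, hr, h⟩ := exists_single_mem_of_zero_mem_interior h0
  refine Metric.isCompact_of_isClosed_isBounded (isClosed_coordPolar K) ?_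
  refine (Metric.isBounded_Icc (fun _ => -(1 / r)) (fun _ => 1 / r)).subset fun u hu => ?_
  have key : ∀ i, ∀ x : ℝ, |x| ≤ r → u i * x ≤ 1 := by
    intro i x hx
    simpa [Pi.single_apply] using hu _ (h i x hx)
  refine ⟨fun i => ?_, fun i => ?_⟩
  · have := key i (-r) (by rw [abs_neg, abs_of_pos hr])
    rw [neg_le, le_div_iff₀ hr]; linarith
  · have := key i r (by rw [abs_of_pos hr])
    rwa [le_div_iff₀ hr]

theorem exists_isSignVector_mul_eq_abs {n : ℕ} (Q : Fin n → ℝ) :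
    ∃ e : Fin n → ℝ, IsSignVector e ∧ ∀ i, e i * Q i = |Q i| := by
  refine ⟨fun i => if 0 ≤ Q i then 1 else -1, fun i => ?_, fun i => ?_⟩
  · by_cases h : 0 ≤ Q i <;> simp [h]
  · by_cases h : 0 ≤ Q i
    · simp [h, abs_of_nonneg h]
    · simp [h, abs_of_neg (not_le.1 h)]

theorem volume_orthantPart_lt_top {n : ℕ} {K : Set (Fin n → ℝ)} (hc : IsCompact K)
    (e : Fin n → ℝ) : volume (orthantPart e K) < ⊤ :=
  lt_of_le_of_lt (measure_mono fun _ h => h.1) hc.measure_lt_top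

theorem isCompact_coordSection {n : ℕ} (i : Fin (n + 1)) {K : Set (Fin (n + 1) → ℝ)}
    (hc : IsCompact K) : IsCompact (coordSection i K) := by
  refine (hc.image (continuous_removeNth i)).of_isClosed_subset
    (isClosed_coordSection i hc.isClosed) fun q hq => ⟨_, hq, by simp⟩

theorem zero_mem_interior_coordSection {n : ℕ} (i : Fin (n + 1)) {K : Set (Fin (n + 1) → ℝ)}
    (h0 : 0 ∈ interior K) : 0 ∈ interior (coordSection i K) := by
  refine mem_interior.2 ⟨{q | i.insertNth (0 : ℝ) q ∈ interior K}, fun q hq => ?_, ?_, ?_⟩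
  · exact interior_subset (s := K) hq
  · exact isOpen_interior.preimage
      ((continuous_insertNth_uncurry i).comp (Continuous.prodMk_right (0 : ℝ)))
  · change i.insertNth (0 : ℝ) (0 : Fin n → ℝ) ∈ interior K
    convert h0 using 1
    ext j
    refine Fin.succAboveCases i ?_ (fun j => ?_) j <;> simp

theorem insertNth_add_smul {n : ℕ} (i : Fin (n + 1)) (a b : ℝ) (p q : Fin n → ℝ) :
    (i.insertNth (0 : ℝ) (a • p + b • q) : Fin (n + 1) → ℝ) =
      a • (i.insertNth (0 : ℝ) p : Fin (n + 1) → ℝ) + b • (i.insertNth (0 : ℝ) q) := by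
  ext j
  refine Fin.succAboveCases i ?_ (fun j => ?_) j <;> simp

theorem convex_coordSection {n : ℕ} (i : Fin (n + 1)) {K : Set (Fin (n + 1) → ℝ)}
    (hK : Convex ℝ K) : Convex ℝ (coordSection i K) := by
  intro p hp q hq a b ha hb hab
  change i.insertNth (0 : ℝ) (a • p + b • q) ∈ K
  rw [insertNth_add_smul]
  exact hK hp hq ha hb hab

theorem neg_mem_coordSection {n : ℕ} (i : Fin (n + 1)) {K : Set (Fin (n + 1) → ℝ)}
    (hK : ∀ p ∈ K, -p ∈ K) : ∀ q ∈ coordSection i K, -q ∈ coordSection i K := by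
  intro q hq
  have := hK _ hq
  change i.insertNth (0 : ℝ) (-q) ∈ K
  convert this using 1
  ext j
  refine Fin.succAboveCases i ?_ (fun j => ?_) j <;> simp

/-! ### Induction on the dimension. -/

/-- If all orthant parts of `K` have volume `V`, and all orthant parts of the `i`-th section have
volume `a i`, then `∑ a i |Q i| ≤ (n + 1) V` on `K`. -/
theorem sum_mul_abs_le {n : ℕ} {K : Set (Fin (n + 1) → ℝ)} (hc : IsCompact K)
    (hK : Convex ℝ K) {V : ℝ} {a : Fin (n + 1) → ℝ}
    (hV : ∀ e, IsSignVector e → volume.real (orthantPart e K) = V)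
    (ha : ∀ i e, IsSignVector e → volume.real (orthantPart e (coordSection i K)) = a i)
    {Q : Fin (n + 1) → ℝ} (hQ : Q ∈ K) : ∑ i, a i * |Q i| ≤ (n + 1) * V := by
  obtain ⟨e, he, heQ⟩ := exists_isSignVector_mul_eq_abs Q
  have h := sum_le_volume_orthantPart hc.isClosed hK hQ (e := e)
    (fun j => by rcases he j with h | h <;> simp [h]) (fun j => by rw [heQ]; exact abs_nonneg _)
  have hfin : ∀ i ∈ (Finset.univ : Finset (Fin (n + 1))), ENNReal.ofReal (|Q i| / (n + 1)) *
        volume (orthantPart (i.removeNth e) (coordSection i K)) ≠ ⊤ := fun i _ =>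
    ENNReal.mul_ne_top ENNReal.ofReal_ne_top
      (volume_orthantPart_lt_top (isCompact_coordSection i hc) _).ne
  have h2 := ENNReal.toReal_mono (volume_orthantPart_lt_top hc e).ne h
  rw [ENNReal.toReal_sum hfin] at h2
  have h3 : ∑ i, a i * |Q i| / (n + 1) ≤ V := by
    rw [← hV e he]
    refine le_trans (le_of_eq (Finset.sum_congr rfl fun i _ => ?_)) h2
    rw [ENNReal.toReal_mul, ENNReal.toReal_ofReal (by positivity),
      ← ha i (i.removeNth e) fun j => he _]
    simp only [Measure.real]; ring
  rw [← Finset.sum_div, div_le_iff₀ (by positivity)] at h3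
  linarith

/-- The inductive step from the coordinate sections of `K` to `K`. -/
theorem le_mul_volume_coordPolar_of_sections {n : ℕ} {K : Set (Fin (n + 1) → ℝ)}
    (hc : IsCompact K) (hK : Convex ℝ K) (h0 : 0 ∈ interior K) {V β : ℝ}
    {a : Fin (n + 1) → ℝ}
    (hV : ∀ e, IsSignVector e → volume.real (orthantPart e K) = V)
    (ha : ∀ i e, IsSignVector e → volume.real (orthantPart e (coordSection i K)) = a i)
    (hβ : ∀ i, β ≤ a i * volume.real (coordPolar (coordSection i K))) :
    2 * β / (n + 1) ≤ V * volume.real (coordPolar K) := by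
  have hsign : ∀ m : ℕ, IsSignVector (1 : Fin m → ℝ) := fun m i => Or.inl rfl
  have ha0 : ∀ i, 0 ≤ a i := fun i => by rw [← ha i 1 (hsign n)]; exact measureReal_nonneg
  have hV0 : 0 < V := by
    rw [← hV 1 (hsign _)]
    refine ENNReal.toReal_pos (ne_of_gt ?_) (volume_orthantPart_lt_top hc 1).ne
    obtain ⟨r, hr, hball⟩ := Metric.mem_nhds_iff.1 (mem_interior_iff_mem_nhds.1 h0)
    have hopen : IsOpen (Metric.ball (0 : Fin (n + 1) → ℝ) r ∩ {p | ∀ i, 0 < p i}) := by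
      refine Metric.isOpen_ball.inter ?_
      rw [Set.ofPred_forall]
      exact isOpen_iInter_of_finite fun i => isOpen_lt continuous_const (continuous_apply i)
    refine lt_of_lt_of_le (hopen.measure_pos volume ⟨fun _ => r / 2, ?_, fun _ => half_pos hr⟩)
      (measure_mono fun p hp => ⟨hball hp.1, fun i => by simpa using hp.2 i⟩)
    rw [mem_ball_zero_iff, pi_norm_lt_iff hr]
    intro i
    rw [Real.norm_eq_abs, abs_of_pos (half_pos hr)]
    exact half_lt_self hr
  -- Scaled so that `sum_mul_abs_le` places the box with half-sides `c * a i` in the polar.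
  set c : ℝ := 1 / ((n + 1) * V) with hcdef
  have hc0 : 0 < c := by positivity
  have hbox : ∀ u : Fin (n + 1) → ℝ, (∀ i, |u i| ≤ c * a i) → u ∈ coordPolar K := by
    intro u hu p hp
    have h := sum_mul_abs_le hc hK hV ha hp
    calc ∑ i, u i * p i ≤ ∑ i, c * (a i * |p i|) := by
          refine Finset.sum_le_sum fun i _ => ?_
          calc u i * p i ≤ |u i| * |p i| := by rw [← abs_mul]; exact le_abs_self _
            _ ≤ c * a i * |p i| := by gcongr; exact hu i
            _ = _ := by ring
      _ = c * ∑ i, a i * |p i| := by rw [Finset.mul_sum]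
      _ ≤ c * ((n + 1) * V) := by gcongr
      _ = 1 := by rw [hcdef]; field_simp
  have hP := isCompact_coordPolar h0
  have h := sum_proj_le_of_box_subset hP (convex_coordPolar K)
    (fun i => mul_nonneg hc0.le (ha0 i)) hbox
  have h2 : ∑ _i : Fin (n + 1), 2 * c * β ≤ (n + 1) * volume.real (coordPolar K) := by
    refine le_trans (Finset.sum_le_sum fun i _ => ?_) h
    have hm : volume.real (coordPolar (coordSection i K)) ≤
        volume.real (i.removeNth '' coordPolar K) :=
      measureReal_mono (coordPolar_section_subset hK h0 i)
        (hP.image (continuous_removeNth i)).measure_lt_top.ne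
    calc 2 * c * β ≤ 2 * c * (a i * volume.real (coordPolar (coordSection i K))) := by
          gcongr; exact hβ i
      _ ≤ 2 * c * (a i * volume.real (i.removeNth '' coordPolar K)) := by
          gcongr; exact ha0 i
      _ = _ := by ring
  rw [Finset.sum_const, Finset.card_univ, Fintype.card_fin, nsmul_eq_mul] at h2
  push_cast at h2
  have h3 : 2 * c * β ≤ volume.real (coordPolar K) :=
    le_of_mul_le_mul_left h2 (by positivity)
  have h4 : 2 * β / (n + 1) = V * (2 * c * β) := by rw [hcdef]; field_simp
  rw [h4]
  gcongr

theorem volume_orthantPart_neg {n : ℕ} {K : Set (Fin n → ℝ)} (hK : ∀ p ∈ K, -p ∈ K)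
    (e : Fin n → ℝ) : volume.real (orthantPart (-e) K) = volume.real (orthantPart e K) := by
  have : orthantPart (-e) K = -orthantPart e K := by
    ext p
    simp only [orthantPart, Set.mem_neg, Set.mem_ofPred_eq, Pi.neg_apply, neg_mul, mul_neg]
    exact and_congr_left fun _ => ⟨fun h => hK p h, fun h => by simpa using hK _ h⟩
  rw [this, Measure.real, Measure.measure_neg, Measure.real]

/-- The one-dimensional case. -/
theorem two_le_mul_volume_coordPolar_one {K : Set (Fin 1 → ℝ)}
    (hc : IsCompact K) (hK : Convex ℝ K) (h0 : 0 ∈ interior K) {V : ℝ}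
    (hV : ∀ e, IsSignVector e → volume.real (orthantPart e K) = V) :
    2 ≤ V * volume.real (coordPolar K) := by
  have hsec : ∀ i, coordSection i K = Set.univ := fun i => by
    ext q
    have := zero_mem_interior_coordSection i h0
    simpa [Subsingleton.elim q 0] using interior_subset this
  -- In dimension `0` the section, its only orthant part and its polar are all the one-point space,
  -- of volume `1`.
  have := le_mul_volume_coordPolar_of_sections hc hK h0 (β := 1) (a := 1) hV
    (fun i e _ => by
      rw [hsec]
      have : orthantPart e (Set.univ : Set (Fin 0 → ℝ)) = Set.univ := by
        ext; simp [orthantPart]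
      simp [this, Measure.real, volume_pi])
    (fun i => by
      have : coordPolar (coordSection i K) = Set.univ := by
        ext; simp [coordPolar]
      simp [this, Measure.real, volume_pi])
  simpa using this

/-- The sections are symmetric intervals, so their two halves have equal length by central symmetry
alone. -/
theorem two_le_mul_volume_coordPolar_two {K : Set (Fin 2 → ℝ)}
    (hc : IsCompact K) (hK : Convex ℝ K) (h0 : 0 ∈ interior K) (hs : ∀ p ∈ K, -p ∈ K) {V : ℝ}
    (hV : ∀ e, IsSignVector e → volume.real (orthantPart e K) = V) :
    2 ≤ V * volume.real (coordPolar K) := by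
  have hsec : ∀ i e, IsSignVector e → volume.real (orthantPart e (coordSection i K)) =
      volume.real (orthantPart 1 (coordSection i K)) := by
    intro i e he
    rcases he 0 with h | h
    · congr 2; ext j; rw [Subsingleton.elim j 0, h]; rfl
    · rw [← volume_orthantPart_neg (neg_mem_coordSection i hs)]
      congr 2; ext j; rw [Subsingleton.elim j 0, Pi.neg_apply, h, neg_neg]; rfl
  have := le_mul_volume_coordPolar_of_sections hc hK h0 (β := 2) hV hsec fun i =>
    two_le_mul_volume_coordPolar_one (isCompact_coordSection i hc) (convex_coordSection i hK)
      (zero_mem_interior_coordSection i h0) (hsec i)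
  norm_num at this ⊢
  exact this

theorem four_thirds_le_mul_volume_coordPolar_three {K : Set (Fin 3 → ℝ)}
    (hc : IsCompact K) (hK : Convex ℝ K) (h0 : 0 ∈ interior K) (hs : ∀ p ∈ K, -p ∈ K) {V : ℝ}
    {a : Fin 3 → ℝ} (hV : ∀ e, IsSignVector e → volume.real (orthantPart e K) = V)
    (ha : ∀ i e, IsSignVector e → volume.real (orthantPart e (coordSection i K)) = a i) :
    4 / 3 ≤ V * volume.real (coordPolar K) := by
  have := le_mul_volume_coordPolar_of_sections hc hK h0 (β := 2) hV ha fun i =>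
    two_le_mul_volume_coordPolar_two (isCompact_coordSection i hc) (convex_coordSection i hK)
      (zero_mem_interior_coordSection i h0) (neg_mem_coordSection i hs) (ha i)
  norm_num at this ⊢
  exact this

theorem volume_orthantPart_eq_closed {n : ℕ} {e : Fin n → ℝ} (he : IsSignVector e)
    (K : Set (Fin n → ℝ)) :
    volume (orthantPart e K) = volume {p | p ∈ K ∧ ∀ i, 0 ≤ e i * p i} := by
  have hne : ∀ᵐ p : Fin n → ℝ, ∀ i, p i ≠ 0 :=
    ae_all_iff.2 fun i => Measure.ae_eval_ne (μ := fun _ : Fin n => (volume : Measure ℝ)) i 0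
  refine measure_congr ?_
  filter_upwards [hne] with p hp
  refine propext (and_congr_right fun _ => forall_congr' fun i => ?_)
  refine ⟨le_of_lt, fun h => lt_of_le_of_ne h (mul_ne_zero ?_ (hp i)).symm⟩
  rcases he i with h | h <;> simp [h]

/-- The `2 ^ n` open orthant parts are disjoint subsets of `K`. -/
theorem two_pow_mul_volume_orthantPart_le {n : ℕ} {K : Set (Fin n → ℝ)} (hc : IsCompact K)
    {V : ℝ} (hV : ∀ e, IsSignVector e → volume.real (orthantPart e K) = V) :
    2 ^ n * V ≤ volume.real K := by
  set e : (Fin n → Bool) → Fin n → ℝ := fun s i => if s i then 1 else -1 with he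
  have hsign : ∀ s, IsSignVector (e s) := fun s i => by
    simp only [he]; split_ifs <;> simp
  have hdisj : ((Finset.univ : Finset (Fin n → Bool)) : Set (Fin n → Bool)).PairwiseDisjoint
      fun s => orthantPart (e s) K := by
    intro s _ t _ hst
    refine Set.disjoint_left.2 fun p hs ht => hst (funext fun i => ?_)
    have h1 := hs.2 i
    have h2 := ht.2 i
    simp only [he] at h1 h2
    cases hsi : s i <;> cases hti : t i <;> simp [hsi, hti] at h1 h2 ⊢ <;> linarith
  have h := measureReal_biUnion_finset (μ := volume) hdisj
    (fun s _ => measurableSet_orthantPart (e s) hc.measurableSet)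
    (fun s _ => (volume_orthantPart_lt_top hc (e s)).ne)
  rw [Finset.sum_congr rfl fun s _ => hV _ (hsign s)] at h
  simp only [Finset.sum_const, Finset.card_univ, Fintype.card_fun, Fintype.card_bool,
    Fintype.card_fin, nsmul_eq_mul, Nat.cast_pow, Nat.cast_ofNat] at h
  rw [← h]
  exact measureReal_mono (Set.iUnion₂_subset fun s _ p hp => hp.1) hc.measure_lt_top.ne

/-! ### Transfer from `E3` to coordinates. -/

/-- The set `K` in the coordinates `Fin 3 → ℝ`. -/
def coordSet (K : Set E3) : Set (Fin 3 → ℝ) := {p | (WithLp.toLp 2 p : E3) ∈ K}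

theorem volume_coordSet {K : Set E3} (hK : MeasurableSet K) : volume (coordSet K) = volume K :=
  (PiLp.volume_preserving_toLp (Fin 3)).measure_preimage hK.nullMeasurableSet

theorem coordPolar_coordSet (K : Set E3) : coordPolar (coordSet K) = coordSet (polarBody K) := by
  ext u
  have key : ∀ x : E3, inner ℝ ((WithLp.toLp 2 u : E3) - 0) (x - 0) = ∑ i, u i * x i := by
    intro x
    simp [PiLp.inner_apply, mul_comm]
  change (∀ p ∈ coordSet K, ∑ i, u i * p i ≤ 1) ↔
    ∀ x ∈ K, inner ℝ ((WithLp.toLp 2 u : E3) - 0) (x - 0) ≤ 1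
  simp only [key]
  exact ⟨fun h x hx => h x.ofLp hx, fun h p hp => h _ hp⟩

theorem isClosed_polarAt (K : Set E3) (z : E3) : IsClosed (polarAt K z) := by
  simp only [polarAt, Set.ofPred_forall]
  exact isClosed_iInter fun p => isClosed_iInter fun _ =>
    isClosed_le (by fun_prop) continuous_const

/-- Central symmetry pairs opposite orthants, so the sign of one coordinate may be fixed; thus four
octants, or two quarters of a section, suffice. -/
theorem orthantPart_volume_eq_of_neg {n : ℕ} {K : Set (Fin n → ℝ)} (hs : ∀ p ∈ K, -p ∈ K)
    (i : Fin n) {V : ℝ}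
    (h : ∀ e, IsSignVector e → e i = 1 → volume.real (orthantPart e K) = V) :
    ∀ e, IsSignVector e → volume.real (orthantPart e K) = V := by
  intro e he
  rcases he i with h1 | h1
  · exact h e he h1
  · rw [← volume_orthantPart_neg hs]
    refine h (-e) (fun j => ?_) (by simp [h1])
    rcases he j with h2 | h2 <;> simp [h2]

theorem volume_orthantPart_coordSet {K A : Set E3} (hA : IsClosed A) {e : Fin 3 → ℝ}
    (he : IsSignVector e)
    (h : ∀ p : E3, p ∈ A ↔ p ∈ K ∧ 0 ≤ e 0 * p 0 ∧ 0 ≤ e 1 * p 1 ∧ 0 ≤ e 2 * p 2) :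
    volume (orthantPart e (coordSet K)) = volume A := by
  rw [volume_orthantPart_eq_closed he, ← volume_coordSet hA.measurableSet]
  congr 1
  ext p
  simp only [coordSet, Set.mem_ofPred_eq, h, Fin.forall_fin_succ, Fin.forall_fin_zero, and_true]
  rfl

theorem isClosed_octants {K : Set E3} (hK : IsClosed K) :
    IsClosed (octant1 K) ∧ IsClosed (octant2 K) ∧ IsClosed (octant3 K) ∧ IsClosed (octant4 K) := by
  have h : ∀ i : Fin 3, Continuous fun p : E3 => p i := fun i => by fun_prop
  have h1 : ∀ i : Fin 3, IsClosed {p : E3 | 0 ≤ p i} := fun i => isClosed_le continuous_const (h i)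
  have h2 : ∀ i : Fin 3, IsClosed {p : E3 | p i ≤ 0} := fun i => isClosed_le (h i) continuous_const
  exact ⟨hK.inter ((h1 0).inter ((h1 1).inter (h1 2))),
    hK.inter ((h2 0).inter ((h1 1).inter (h1 2))),
    hK.inter ((h2 0).inter ((h2 1).inter (h1 2))),
    hK.inter ((h1 0).inter ((h2 1).inter (h1 2)))⟩

theorem volume_orthantPart_of_equipartitioned {K : Set E3} (hK : IsClosed K)
    (hs : ∀ p ∈ coordSet K, -p ∈ coordSet K) (heq : IsEquipartitioned K) :
    ∀ e, IsSignVector e →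
      volume.real (orthantPart e (coordSet K)) = volume.real (octant1 K) := by
  obtain ⟨c1, c2, c3, c4⟩ := isClosed_octants hK
  refine orthantPart_volume_eq_of_neg hs 2 fun e he h2 => congrArg ENNReal.toReal ?_
  rcases he 0 with h0 | h0 <;> rcases he 1 with h1 | h1
  · exact volume_orthantPart_coordSet c1 he fun p => by simp [octant1, h0, h1, h2]
  · rw [heq.vol12, heq.vol23, heq.vol34]
    exact volume_orthantPart_coordSet c4 he fun p => by simp [octant4, h0, h1, h2]
  · rw [heq.vol12]
    exact volume_orthantPart_coordSet c2 he fun p => by simp [octant2, h0, h1, h2]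
  · rw [heq.vol12, heq.vol23]
    exact volume_orthantPart_coordSet c3 he fun p => by simp [octant3, h0, h1, h2]

theorem volume_orthantPart_two {L : Set (Fin 2 → ℝ)} {B : Set (ℝ × ℝ)}
    {e : Fin 2 → ℝ} (he : IsSignVector e)
    (h : ∀ q : Fin 2 → ℝ, (q 0, q 1) ∈ B ↔ q ∈ L ∧ 0 ≤ e 0 * q 0 ∧ 0 ≤ e 1 * q 1) :
    volume (orthantPart e L) = volume B := by
  rw [volume_orthantPart_eq_closed he,
    ← (volume_preserving_finTwoArrow ℝ).measure_preimage_equiv B]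
  congr 1
  ext q
  have : q ∈ MeasurableEquiv.finTwoArrow ⁻¹' B ↔ (q 0, q 1) ∈ B := Iff.rfl
  rw [this, h, Set.mem_ofPred_eq, Fin.forall_fin_two]

theorem volume_orthantPart_section_of_equipartitioned {K : Set E3}
    (hs : ∀ p ∈ coordSet K, -p ∈ coordSet K) (heq : IsEquipartitioned K) (i : Fin 3) :
    ∀ e, IsSignVector e → volume.real (orthantPart e (coordSection i (coordSet K))) =
      ![volume.real (quarterD K), volume.real (quarterF K), volume.real (quarterH K)] i := by
  have i0 : ∀ q : Fin 2 → ℝ,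
      (WithLp.toLp 2 (Fin.cons (0 : ℝ) q : Fin 3 → ℝ) : E3) = !₂[0, q 0, q 1] := by
    intro q; ext j; fin_cases j <;> rfl
  have i1 : ∀ q : Fin 2 → ℝ,
      (WithLp.toLp 2 ((1 : Fin 3).insertNth (0 : ℝ) q : Fin 3 → ℝ) : E3) = !₂[q 0, 0, q 1] := by
    intro q; ext j; fin_cases j <;> rfl
  have i2 : ∀ q : Fin 2 → ℝ,
      (WithLp.toLp 2 ((2 : Fin 3).insertNth (0 : ℝ) q : Fin 3 → ℝ) : E3) = !₂[q 0, q 1, 0] := by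
    intro q; ext j; fin_cases j <;> rfl
  have hneg := fun i => neg_mem_coordSection i hs
  -- In each plane the fixed sign is that of the coordinate nonnegative on both of the quarters
  -- compared: `z`, `x` and `y` respectively.
  fin_cases i
  · refine orthantPart_volume_eq_of_neg (hneg 0) 1 fun e he h1 => congrArg ENNReal.toReal ?_
    rcases he 0 with h0 | h0
    · exact volume_orthantPart_two he fun q => by
        simp [quarterD, coordSection, coordSet, i0, h0, h1]
    · rw [heq.areaDE]
      exact volume_orthantPart_two he fun q => by
        simp [quarterE, coordSection, coordSet, i0, h0, h1]
  · refine orthantPart_volume_eq_of_neg (hneg 1) 0 fun e he h0 => congrArg ENNReal.toReal ?_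
    rcases he 1 with h1 | h1
    · exact volume_orthantPart_two he fun q => by
        simp [quarterF, coordSection, coordSet, i1, h0, h1]
    · rw [heq.areaFG]
      exact volume_orthantPart_two he fun q => by
        simp [quarterG, coordSection, coordSet, i1, h0, h1]
  · refine orthantPart_volume_eq_of_neg (hneg 2) 1 fun e he h1 => congrArg ENNReal.toReal ?_
    rcases he 0 with h0 | h0
    · exact volume_orthantPart_two he fun q => by
        simp [quarterH, coordSection, coordSet, i2, h0, h1]
    · rw [heq.areaHI]
      exact volume_orthantPart_two he fun q => by
        simp [quarterI, coordSection, coordSet, i2, h0, h1]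

theorem zero_mem_interior_of_symm {E : Type*} [NormedAddCommGroup E] [NormedSpace ℝ E] {K : Set E}
    (hK : Convex ℝ K) (hs : K = -K) (hne : (interior K).Nonempty) : 0 ∈ interior K := by
  obtain ⟨x, hx⟩ := hne
  have hx' : -x ∈ interior K := by
    rw [hs]
    exact preimage_interior_subset_interior_preimage continuous_neg
      (show - -x ∈ interior K by rwa [neg_neg])
  have := hK.interior hx hx' (a := 1 / 2) (b := 1 / 2) (by norm_num) (by norm_num) (by norm_num)
  simpa using this

theorem le_volume_mul_volume_polarBody {K : Set E3} (hc : IsCompact K) (hK : Convex ℝ K)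
    (h0 : 0 ∈ interior K) (hs : ∀ x ∈ K, -x ∈ K) (heq : IsEquipartitioned K) :
    (32 / 3 : ℝ≥0∞) ≤ volume K * volume (polarBody K) := by
  have hcont : Continuous fun p : Fin 3 → ℝ => (WithLp.toLp 2 p : E3) :=
    PiLp.continuous_toLp 2 _
  have hc' : IsCompact (coordSet K) :=
    (PiLp.homeomorph 2 fun _ : Fin 3 => ℝ).symm.isClosedEmbedding.isCompact_preimage hc
  have hK' : Convex ℝ (coordSet K) :=
    hK.linear_preimage (WithLp.linearEquiv 2 ℝ (Fin 3 → ℝ)).symm.toLinearMap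
  have h0' : 0 ∈ interior (coordSet K) := by
    refine preimage_interior_subset_interior_preimage hcont ?_
    simpa using h0
  have hs' : ∀ p ∈ coordSet K, -p ∈ coordSet K := fun p hp => hs _ hp
  have hV := volume_orthantPart_of_equipartitioned hc.isClosed hs' heq
  have h1 := four_thirds_le_mul_volume_coordPolar_three hc' hK' h0' hs' hV
    (volume_orthantPart_section_of_equipartitioned hs' heq)
  have h2 := two_pow_mul_volume_orthantPart_le hc' hV
  -- `8 * (4 / 3) = 32 / 3`.
  have h3 : 32 / 3 ≤ volume.real (coordSet K) * volume.real (coordPolar (coordSet K)) := by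
    have : (0 : ℝ) ≤ volume.real (coordPolar (coordSet K)) := measureReal_nonneg
    nlinarith
  have h4 : ENNReal.ofReal (32 / 3) ≤ volume (coordSet K) * volume (coordPolar (coordSet K)) := by
    refine ENNReal.ofReal_le_of_le_toReal ?_
    rw [ENNReal.toReal_mul]
    exact h3
  rw [coordPolar_coordSet, volume_coordSet hc.measurableSet,
    volume_coordSet (K := polarBody K) (isClosed_polarAt K 0).measurableSet] at h4
  convert h4 using 1
  rw [ENNReal.ofReal_div_of_pos (by norm_num)]
  simp

/-! ### Moving the centre of polarity. -/

theorem lintegral_Ioi_exp_neg (c : ℝ) :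
    ∫⁻ r in Set.Ioi c, ENNReal.ofReal (Real.exp (-r)) = ENNReal.ofReal (Real.exp (-c)) := by
  rw [← integral_exp_neg_Ioi c, ofReal_integral_eq_lintegral_ofReal (integrableOn_exp_neg_Ioi c)
    (Filter.Eventually.of_forall fun r => (Real.exp_pos _).le)]

theorem lintegral_Ioi_exp_neg_mul_cube :
    ∫⁻ r in Set.Ioi (0 : ℝ), ENNReal.ofReal (Real.exp (-r)) * ENNReal.ofReal (r ^ 3) = 6 := by
  have h := Real.GammaIntegral_convergent (s := 4) (by norm_num)
  have h2 := Real.Gamma_eq_integral (s := 4) (by norm_num)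
  have e : ∀ x : ℝ, Real.exp (-x) * x ^ ((4 : ℝ) - 1) = Real.exp (-x) * x ^ 3 := fun x => by
    rw [show (4 : ℝ) - 1 = (3 : ℕ) by norm_num, Real.rpow_natCast]
  simp only [e] at h h2
  have h3 : Real.Gamma 4 = 6 := by
    have := Real.Gamma_nat_eq_factorial 3
    rw [show ((3 : ℕ) : ℝ) + 1 = 4 by norm_num] at this
    rw [this]; norm_num [Nat.factorial]
  have h4 := ofReal_integral_eq_lintegral_ofReal h
    ((ae_restrict_iff' measurableSet_Ioi).2 (Filter.Eventually.of_forall fun r hr => by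
      have : (0 : ℝ) < r := hr
      change 0 ≤ Real.exp (-r) * r ^ 3
      positivity))
  rw [← h2, h3] at h4
  simp_rw [← ENNReal.ofReal_mul (Real.exp_pos _).le]
  rw [← h4]
  simp

/-- The set of functionals bounded by `r` on `K - z`. -/
def polarLevel (K : Set E3) (z : E3) (r : ℝ) : Set E3 := {u | ∀ v ∈ K, inner ℝ u (v - z) ≤ r}

theorem isClosed_polarLevel_uncurry (K : Set E3) (z : E3) :
    IsClosed {p : E3 × ℝ | p.1 ∈ polarLevel K z p.2} := by
  change IsClosed {p : E3 × ℝ | ∀ v ∈ K, inner ℝ p.1 (v - z) ≤ p.2}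
  simp only [Set.ofPred_forall]
  exact isClosed_iInter fun v => isClosed_iInter fun _ =>
    isClosed_le (by fun_prop) continuous_snd

theorem volume_polarLevel (K : Set E3) (z : E3) {r : ℝ} (hr : 0 < r) :
    volume (polarLevel K z r) = ENNReal.ofReal (r ^ 3) * volume (polarAt K z) := by
  have h1 : polarLevel K z r = r • polarLevel K z 1 := by
    ext u
    rw [Set.mem_smul_set_iff_inv_smul_mem₀ hr.ne']
    refine forall₂_congr fun v _ => ?_
    rw [inner_smul_left, RCLike.conj_to_real, inv_mul_le_iff₀ hr, mul_one]
  have h2 : polarAt K z = (fun u => u + -z) ⁻¹' polarLevel K z 1 := by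
    ext u
    simp [polarAt, polarLevel, sub_eq_add_neg]
  rw [h1, h2, measure_preimage_add_right, Measure.addHaar_smul, finrank_euclideanSpace_fin,
    abs_of_pos (by positivity)]

/-- Six times the volume of a polar body is the integral of `exp` of minus its gauge. -/
theorem lintegral_exp_neg_eq_volume_polarAt {K : Set E3} {z : E3} {g : E3 → ℝ}
    (hg : ∀ u, 0 ≤ g u) (h : ∀ u r, u ∈ polarLevel K z r ↔ g u ≤ r) :
    ∫⁻ u, ENNReal.ofReal (Real.exp (-g u)) = 6 * volume (polarAt K z) := by
  have hmeas : Measurable fun p : E3 × ℝ =>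
      {p : E3 × ℝ | p.1 ∈ polarLevel K z p.2}.indicator
        (fun p => ENNReal.ofReal (Real.exp (-p.2))) p :=
    Measurable.indicator (by fun_prop) (isClosed_polarLevel_uncurry K z).measurableSet
  -- Layer cake: `exp (-g u)` is the integral of `exp (-r)` over `r > g u`. After exchanging
  -- integrals, the level sets have volume `r ^ 3` times that of the polar, and `Γ(4) = 6`.
  calc ∫⁻ u, ENNReal.ofReal (Real.exp (-g u))
      = ∫⁻ u, ∫⁻ r in Set.Ioi (0 : ℝ), {p : E3 × ℝ | p.1 ∈ polarLevel K z p.2}.indicator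
          (fun p => ENNReal.ofReal (Real.exp (-p.2))) (u, r) := by
        refine lintegral_congr fun u => ?_
        have : ∀ r : ℝ, {p : E3 × ℝ | p.1 ∈ polarLevel K z p.2}.indicator
            (fun p => ENNReal.ofReal (Real.exp (-p.2))) (u, r) =
            (Set.Ici (g u)).indicator (fun r => ENNReal.ofReal (Real.exp (-r))) r := by
          intro r
          simp only [Set.indicator, Set.mem_ofPred_eq, h, Set.mem_Ici]
        simp_rw [this]
        rw [lintegral_indicator measurableSet_Ici, Measure.restrict_restrict measurableSet_Ici,
          ← lintegral_Ioi_exp_neg]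
        refine setLIntegral_congr ?_
        have hI : (Set.Ioi (g u) : Set ℝ) = Set.Ioi (g u) ∩ Set.Ioi 0 :=
          (Set.inter_eq_left.2 (Set.Ioi_subset_Ioi (hg u))).symm
        rw [hI]
        exact Ioi_ae_eq_Ici.inter (Filter.EventuallyEq.refl _ _)
    _ = ∫⁻ r in Set.Ioi (0 : ℝ), ∫⁻ u, {p : E3 × ℝ | p.1 ∈ polarLevel K z p.2}.indicator
          (fun p => ENNReal.ofReal (Real.exp (-p.2))) (u, r) :=
        lintegral_lintegral_swap hmeas.aemeasurable
    _ = ∫⁻ r in Set.Ioi (0 : ℝ), ENNReal.ofReal (Real.exp (-r)) * ENNReal.ofReal (r ^ 3) *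
          volume (polarAt K z) := by
        refine setLIntegral_congr_fun measurableSet_Ioi fun r hr => ?_
        have : ∀ u : E3, {p : E3 × ℝ | p.1 ∈ polarLevel K z p.2}.indicator
            (fun p => ENNReal.ofReal (Real.exp (-p.2))) (u, r) =
            (polarLevel K z r).indicator (fun _ => ENNReal.ofReal (Real.exp (-r))) u := fun u => rfl
        simp_rw [this]
        rw [lintegral_indicator_const, volume_polarLevel K z hr, mul_assoc]
        have hcl := (isClosed_polarLevel_uncurry K z).preimage (Continuous.prodMk_left r)
        exact hcl.measurableSet
    _ = 6 * volume (polarAt K z) := by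
        rw [lintegral_mul_const _ (by fun_prop), lintegral_Ioi_exp_neg_mul_cube]

theorem volume_polarAt_neg {K : Set E3} (hs : ∀ x ∈ K, -x ∈ K) (z : E3) :
    volume (polarAt K (-z)) = volume (polarAt K z) := by
  have : polarAt K (-z) = -polarAt K z := by
    ext u
    rw [Set.mem_neg]
    have key : ∀ v, inner ℝ (-u - z) (-v - z) = inner ℝ (u - -z) (v - -z) := fun v => by
      rw [← inner_neg_neg]; congr 1 <;> abel
    refine ⟨fun h v hv => ?_, fun h v hv => ?_⟩
    · have := h _ (hs v hv)
      rwa [← key, neg_neg] at this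
    · have := h _ (hs v hv)
      rwa [key] at this
  rw [this, Measure.measure_neg]

/-- For a symmetric body the volume of the polar is smallest with respect to the centre. -/
theorem volume_polarBody_le_polarAt {K : Set E3} (hc : IsCompact K) (hs : ∀ x ∈ K, -x ∈ K)
    {z : E3} (hz : z ∈ K) : volume (polarBody K) ≤ volume (polarAt K z) := by
  have hmax : ∀ u : E3, ∃ v ∈ K, ∀ x ∈ K, inner ℝ u x ≤ inner ℝ u v := fun u => by
    obtain ⟨v, hv, h⟩ := hc.exists_isMaxOn ⟨z, hz⟩
      (f := fun x => inner ℝ u x) (by fun_prop)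
    exact ⟨v, hv, fun x hx => h hx⟩
  -- `inner ℝ u (m u)` is the support function of `K` at `u`; subtracting `inner ℝ u z` gives the
  -- gauge of the polar about `z`.
  choose m hm hmle using hmax
  have level : ∀ y u r, u ∈ polarLevel K y r ↔ inner ℝ u (m u) - inner ℝ u y ≤ r := by
    intro y u r
    rw [← inner_sub_right]
    refine ⟨fun h => h _ (hm u), fun h v hv => le_trans ?_ h⟩
    rw [inner_sub_right, inner_sub_right]
    exact sub_le_sub_right (hmle u v hv) _
  have h1 := lintegral_exp_neg_eq_volume_polarAt (K := K) (z := z)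
    (fun u => sub_nonneg.2 (hmle u z hz)) (level z)
  have h2 := lintegral_exp_neg_eq_volume_polarAt (K := K) (z := -z)
    (fun u => sub_nonneg.2 (hmle u _ (hs z hz))) (level (-z))
  have h3 := lintegral_exp_neg_eq_volume_polarAt (K := K) (z := 0)
    (g := fun u => inner ℝ u (m u) - inner ℝ u (0 : E3))
    (fun u => by
      have a := hmle u z hz
      have b := hmle u _ (hs z hz)
      rw [inner_neg_right] at b
      rw [inner_zero_right]
      linarith) (level 0)
  rw [volume_polarAt_neg hs] at h2
  have key : 2 * (6 * volume (polarAt K 0)) ≤ 2 * (6 * volume (polarAt K z)) := by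
    rw [two_mul (6 * volume (polarAt K z))]
    nth_rewrite 1 [← h1]
    rw [← h2, ← h3, ← lintegral_const_mul' _ _ (by simp)]
    -- The maximiser `m` is an arbitrary choice, so measurability comes from the closed sublevel
    -- sets.
    have hmeas : Measurable fun u => inner ℝ u (m u) - inner ℝ u z := by
      refine measurable_of_Iic fun r => ?_
      have hcl := (isClosed_polarLevel_uncurry K z).preimage (Continuous.prodMk_left r)
      convert hcl.measurableSet using 1
      ext u
      exact (level z u r).symm
    rw [← lintegral_add_left (by fun_prop)]
    refine lintegral_mono fun u => ?_
    rw [two_mul, ← ENNReal.ofReal_add (Real.exp_pos _).le (Real.exp_pos _).le,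
      ← ENNReal.ofReal_add (Real.exp_pos _).le (Real.exp_pos _).le]
    refine ENNReal.ofReal_le_ofReal ?_
    -- The polars about `z` and `-z` have equal volume; adding their integrands gives `2 cosh (inner
    -- ℝ u z)` times the integrand for centre `0`.
    have hcosh := Real.one_le_cosh (inner ℝ u z)
    rw [Real.cosh_eq] at hcosh
    rw [inner_zero_right, inner_neg_right, sub_zero, neg_sub, sub_neg_eq_add, neg_add,
      sub_eq_add_neg, Real.exp_add, Real.exp_add]
    nlinarith [Real.exp_pos (-inner ℝ u (m u))]
  have h12 := (ENNReal.mul_le_mul_iff_right (by simp) (by simp)).1 key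
  exact (ENNReal.mul_le_mul_iff_right (by simp) (by simp)).1 h12

theorem mainTheorem4 (K : ConvexBody E3) (hK : IsSmoothStronglyConvexSymm K)
    (heq : IsEquipartitioned (K : Set E3)) :
    (32 / 3 : ℝ≥0∞) ≤ volumeProduct (K : Set E3) ∧
      (32 / 3 : ℝ≥0∞) ≤ volume (K : Set E3) * volume (polarBody (K : Set E3)) := by
  have hs : ∀ x ∈ (K : Set E3), -x ∈ (K : Set E3) := fun x hx => by
    rw [hK.symm]; simpa using hx
  have h0 := zero_mem_interior_of_symm K.convex hK.symm hK.nonempty_interior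
  have h := le_volume_mul_volume_polarBody K.isCompact K.convex h0 hs heq
  refine ⟨le_iInf₂ fun z hz => h.trans ?_, h⟩
  exact mul_le_mul_right (volume_polarBody_le_polarAt K.isCompact hs (interior_subset hz)) _
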